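/- Let $\mathbb F$ be a field. Let $\mathbf{Assoc}$ be the category of associative (not necessarily unital) $\mathbb F$-algebras, with the linear multiplicative maps as morphisms, and let $\mathbf{CAssoc}$ be its full subcategory of commutative associative algebras. An \emph{amalgam} of a diagram in a category is a cocone on that diagram all of whose components are monomorphisms. Let $S \xleftarrow{s} I \xrightarrow{t} T$ be a span in $\mathbf{CAssoc}$. (a) If the span admits an amalgam in $\mathbf{Assoc}$, then it admits an amalgam in $\mathbf{CAssoc}$. (b) Monicity of the pushout injections is preserved on passing to the commutative pushout: let $\iota_S\colon S\to S+_I^{\mathbf{Assoc}}T$ and $\iota_T\colon T\to S+_I^{\mathbf{Assoc}}T$ be the injections of the pushout of the span in $\mathbf{Assoc}$, and $\kappa_S\colon S\to S+_I^{\mathbf{CAssoc}}T$ and $\kappa_T\colon T\to S+_I^{\mathbf{CAssoc}}T$ those of its pushout in $\mathbf{CAssoc}$. If $\iota_S$ is a monomorphism, then so is $\kappa_S$; and if $\iota_T$ is a monomorphism, then so is $\kappa_T$. -/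

import Mathlib

open CategoryTheory CategoryTheory.Limits

universe u v

/-- An object of the category of associative algebras over the field `F`: an `F`-vector space
with a bilinear associative multiplication; a unit element is not required. -/
structure Assoc (F : Type u) [Field F] where
  carrier : Type v
  [ring : NonUnitalRing carrier]
  [module : Module F carrier]
  [isScalarTower : IsScalarTower F carrier carrier]
  [smulCommClass : SMulCommClass F carrier carrier]

/-- An object of the category of commutative associative algebras over the field `F`: an
`F`-vector space with a bilinear, associative and commutative multiplication; a unit element is
not required. -/
structure CAssoc (F : Type u) [Field F] where
  carrier : Type v
  [ring : NonUnitalCommRing carrier]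
  [module : Module F carrier]
  [isScalarTower : IsScalarTower F carrier carrier]
  [smulCommClass : SMulCommClass F carrier carrier]

attribute [instance] Assoc.ring Assoc.module Assoc.isScalarTower Assoc.smulCommClass
attribute [instance] CAssoc.ring CAssoc.module CAssoc.isScalarTower CAssoc.smulCommClass

/-- Morphisms of associative algebras are the linear maps that preserve the multiplication. -/
instance Assoc.category (F : Type u) [Field F] : Category.{v} (Assoc.{u, v} F) where
  Hom A B := A.carrier →ₙₐ[F] B.carrier
  id A := NonUnitalAlgHom.id F A.carrier
  comp f g := NonUnitalAlgHom.comp g f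

/-- Morphisms of commutative associative algebras are the linear maps that preserve the
multiplication. -/
instance CAssoc.category (F : Type u) [Field F] : Category.{v} (CAssoc.{u, v} F) where
  Hom A B := A.carrier →ₙₐ[F] B.carrier
  id A := NonUnitalAlgHom.id F A.carrier
  comp f g := NonUnitalAlgHom.comp g f

/-- The forgetful functor from commutative associative algebras to associative algebras. -/
def CAssoc.U (F : Type u) [Field F] : CAssoc.{u, v} F ⥤ Assoc.{u, v} F where
  obj A := { carrier := A.carrier }
  map f := f

/-- An amalgam for a diagram `D` is a monic cocone, that is, a cocone on `D` each of whose
components is a monomorphism. -/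
def HasAmalgam {J : Type*} [Category J] {C : Type*} [Category C] (D : J ⥤ C) : Prop :=
  ∃ c : Cocone D, ∀ j : J, Mono (c.ι.app j)

open scoped TensorProduct

namespace AlgHom

/-! Adjoin units to pass to `f : S¹ → P¹` and `g : T¹ → P¹`, and let `J` be the ideal of `S¹ ⊗ T¹`
generated by all `s i ⊗ 1 - 1 ⊗ t i`. The quotient by `J` is a commutative cocone. As `P` need not
be commutative, `x ⊗ y ↦ f x * g y` is only linear, but it still kills `J`, so it factors linearly
through the quotient. On the legs it restricts to `ιS` and `ιT`, so elements identified in the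
quotient were already identified in `P`. Both parts follow, (b) because this cocone factors through
the commutative pushout. -/

/-- The linear map `x ⊗ y ↦ f x * g y`, defined without assuming that the values of `f` and `g`
commute. -/
noncomputable def mulTensor {F X Y P : Type*} [CommRing F] [CommRing X] [CommRing Y] [Ring P]
    [Algebra F X] [Algebra F Y] [Algebra F P] (f : X →ₐ[F] P) (g : Y →ₐ[F] P) :
    X ⊗[F] Y →ₗ[F] P :=
  TensorProduct.lift ((LinearMap.mul F P).compl₁₂ f.toLinearMap g.toLinearMap)

theorem mulTensor_tmul {F X Y P : Type*} [CommRing F] [CommRing X] [CommRing Y] [Ring P]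
    [Algebra F X] [Algebra F Y] [Algebra F P] (f : X →ₐ[F] P) (g : Y →ₐ[F] P) (x : X) (y : Y) :
    mulTensor f g (x ⊗ₜ y) = f x * g y := by
  simp [mulTensor]

/-- If `f` and `g` agree on `R` along `σ` and `τ`, then the map `x ⊗ y ↦ f x * g y` kills the ideal
that identifies the two images of `R`. -/
theorem mulTensor_eq_zero_of_mem_span {F R X Y P : Type*} [CommRing F] [CommRing X] [CommRing Y]
    [Ring P] [Algebra F X] [Algebra F Y] [Algebra F P] (f : X →ₐ[F] P) (g : Y →ₐ[F] P)
    (σ : R → X) (τ : R → Y) (h : ∀ r, f (σ r) = g (τ r)) {z : X ⊗[F] Y}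
    (hz : z ∈ Ideal.span
      (Set.range fun r : R => σ r ⊗ₜ[F] (1 : Y) - (1 : X) ⊗ₜ[F] τ r)) :
    mulTensor f g z = 0 := by
  induction hz using Submodule.span_induction with
  | zero => exact map_zero _
  | add _ _ _ _ hx hy => rw [map_add, hx, hy, add_zero]
  | mem z hz =>
    obtain ⟨r, rfl⟩ := hz
    simp [mulTensor_tmul, h]
  -- `mulTensor f g` is not multiplicative, so its vanishing at `z` says nothing about `w • z`; a
  -- second induction treats all multipliers `w` at once.
  | smul w z hz hz0 =>
    clear hz0
    induction hz using Submodule.span_induction generalizing w with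
    | zero => simp
    | add _ _ _ _ hx hy => rw [smul_add, map_add, hx, hy, add_zero]
    | smul v z _ hz => rw [smul_smul]; exact hz _
    | mem z hz =>
      obtain ⟨r, rfl⟩ := hz
      induction w with
      | zero => simp
      | add _ _ hx hy => rw [add_smul, map_add, hx, hy, add_zero]
      | tmul x y =>
        simp only [smul_eq_mul, mul_sub, Algebra.TensorProduct.tmul_mul_tmul, mul_one, map_sub,
          mulTensor_tmul, map_mul]
        -- Commutativity of `Y` moves `g (τ r)` past `g y`; images of `f` and `g` are never
        -- commuted.
        rw [h, mul_assoc, ← map_mul, ← map_mul, mul_comm y, sub_self]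

end AlgHom

/-- Used to bring the quotient of the tensor product, which lives in `max u v`, down to universe
`v`. -/
theorem small_field_of_nontrivial (F : Type u) [Field F] (M : Type v) [AddCommGroup M] [Module F M]
    [Nontrivial M] : Small.{v} F := by
  obtain ⟨x, hx⟩ := exists_ne (0 : M)
  exact small_of_injective (smul_left_injective F hx)

theorem small_unitization (F : Type u) [Small.{v} F] (M : Type v) : Small.{v} (Unitization F M) :=
  small_of_injective (f := fun x : Unitization F M => (x.fst, x.snd)) fun _ _ h =>
    Unitization.ext (congrArg Prod.fst h) (congrArg Prod.snd h)

/-- A unital commutative algebra, regarded as an object of `CAssoc F`. -/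
abbrev CAssoc.ofAlgebra (F : Type u) [Field F] (B : Type v) [CommRing B] [Algebra F B] :
    CAssoc.{u, v} F where
  carrier := B
  module := Algebra.toModule

/-- A cocone of a span of commutative algebras with values in an associative algebra can be
replaced by one with values in a commutative algebra that identifies no further elements of either
leg. -/
theorem CAssoc.exists_commutative_cocone {F : Type u} [Field F] {I S T P : Type v}
    [NonUnitalCommRing I] [Module F I]
    [IsScalarTower F I I] [SMulCommClass F I I] [NonUnitalCommRing S] [Module F S]
    [IsScalarTower F S S] [SMulCommClass F S S] [NonUnitalCommRing T] [Module F T]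
    [IsScalarTower F T T] [SMulCommClass F T T] [NonUnitalRing P] [Module F P]
    [IsScalarTower F P P] [SMulCommClass F P P] (s : I →ₙₐ[F] S) (t : I →ₙₐ[F] T)
    (ιS : S →ₙₐ[F] P) (ιT : T →ₙₐ[F] P) (h : ∀ i, ιS (s i) = ιT (t i)) :
    ∃ (Q : CAssoc.{u, v} F) (κS : S →ₙₐ[F] Q.carrier) (κT : T →ₙₐ[F] Q.carrier),
      (∀ i, κS (s i) = κT (t i)) ∧ (∀ a b, κS a = κS b → ιS a = ιS b) ∧
      (∀ a b, κT a = κT b → ιT a = ιT b) := by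
  -- If both legs are zero, `F` need not be `v`-small, but the zero algebra serves as `Q`.
  by_cases hST : Subsingleton S ∧ Subsingleton T
  · obtain ⟨_, _⟩ := hST
    exact ⟨⟨S⟩, 0, 0, fun _ => rfl, fun a b _ => congrArg _ (Subsingleton.elim a b),
      fun a b _ => congrArg _ (Subsingleton.elim a b)⟩
  have : Small.{v} F := by
    rw [not_and_or, not_subsingleton_iff_nontrivial, not_subsingleton_iff_nontrivial] at hST
    rcases hST with _ | _
    · exact small_field_of_nontrivial F S
    · exact small_field_of_nontrivial F T
  have := small_unitization F S
  have := small_unitization F T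
  let f : Unitization F S →ₐ[F] Unitization F P :=
    Unitization.lift ((Unitization.inrNonUnitalAlgHom F P).comp ιS)
  let g : Unitization F T →ₐ[F] Unitization F P :=
    Unitization.lift ((Unitization.inrNonUnitalAlgHom F P).comp ιT)
  have hf (a : S) : f (a : Unitization F S) = (ιS a : Unitization F P) := by simp [f]
  have hg (a : T) : g (a : Unitization F T) = (ιT a : Unitization F P) := by simp [g]
  let J : Ideal (Unitization F S ⊗[F] Unitization F T) := Ideal.span (Set.range fun i : I =>
    (s i : Unitization F S) ⊗ₜ[F] (1 : Unitization F T) -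
      (1 : Unitization F S) ⊗ₜ[F] (t i : Unitization F T))
  have hJ {z} (hz : z ∈ J) : AlgHom.mulTensor f g z = 0 :=
    AlgHom.mulTensor_eq_zero_of_mem_span f g (fun i => (s i : Unitization F S))
      (fun i => (t i : Unitization F T)) (fun i => by rw [hf, hg, h]) hz
  let A := (Unitization F S ⊗[F] Unitization F T) ⧸ J
  have : Small.{v} A := small_of_surjective (Ideal.Quotient.mk_surjective (I := J))
  let π : Unitization F S ⊗[F] Unitization F T →ₐ[F] Shrink.{v} A :=
    ((Shrink.algEquiv F A).symm : A →ₐ[F] Shrink.{v} A).comp (Ideal.Quotient.mkₐ F J)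
  have hπ {x y} (hxy : π x = π y) : AlgHom.mulTensor f g x = AlgHom.mulTensor f g y := by
    rw [← sub_eq_zero, ← map_sub]
    exact hJ (Ideal.Quotient.eq.mp ((Shrink.algEquiv F A).symm.injective hxy))
  refine ⟨CAssoc.ofAlgebra F (Shrink.{v} A),
    ((π.comp Algebra.TensorProduct.includeLeft : Unitization F S →ₐ[F] Shrink.{v} A) :
      Unitization F S →ₙₐ[F] Shrink.{v} A).comp (Unitization.inrNonUnitalAlgHom F S),
    ((π.comp Algebra.TensorProduct.includeRight : Unitization F T →ₐ[F] Shrink.{v} A) :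
      Unitization F T →ₙₐ[F] Shrink.{v} A).comp (Unitization.inrNonUnitalAlgHom F T),
    fun i => ?_, fun a b hab => ?_, fun a b hab => ?_⟩
  · exact congrArg (Shrink.algEquiv F A).symm
      (Ideal.Quotient.eq.mpr (Ideal.subset_span ⟨i, rfl⟩))
  · have := hπ (x := (a : Unitization F S) ⊗ₜ 1) (y := (b : Unitization F S) ⊗ₜ 1) hab
    rw [AlgHom.mulTensor_tmul, AlgHom.mulTensor_tmul, hf, hf, map_one, mul_one, mul_one] at this
    exact Unitization.inr_injective this
  · have := hπ (x := 1 ⊗ₜ (a : Unitization F T)) (y := 1 ⊗ₜ (b : Unitization F T)) hab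
    rw [AlgHom.mulTensor_tmul, AlgHom.mulTensor_tmul, hg, hg, map_one, one_mul, one_mul] at this
    exact Unitization.inr_injective this

/-- The algebra homomorphism underlying a morphism of `Assoc F`. -/
def Assoc.toHom {F : Type u} [Field F] {A B : Assoc.{u, v} F} (f : A ⟶ B) :
    A.carrier →ₙₐ[F] B.carrier := f

/-- The algebra homomorphism underlying a morphism of `CAssoc F`. -/
def CAssoc.toHom {F : Type u} [Field F] {A B : CAssoc.{u, v} F} (f : A ⟶ B) :
    A.carrier →ₙₐ[F] B.carrier := f

theorem Assoc.injective_of_mono {F : Type u} [Field F] {A B : Assoc.{u, v} F} (f : A ⟶ B)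
    [Mono f] : Function.Injective (Assoc.toHom f) := by
  intro a b hab
  -- Monicity is tested on the two projections of the kernel pair of `f`.
  let K : NonUnitalSubalgebra F (A.carrier × A.carrier) := NonUnitalAlgHom.equalizer
    ((Assoc.toHom f).comp (NonUnitalAlgHom.fst F A.carrier A.carrier))
    ((Assoc.toHom f).comp (NonUnitalAlgHom.snd F A.carrier A.carrier))
  let p : (⟨K⟩ : Assoc.{u, v} F) ⟶ A :=
    (NonUnitalAlgHom.fst F A.carrier A.carrier).comp (NonUnitalSubalgebraClass.subtype K)
  let q : (⟨K⟩ : Assoc.{u, v} F) ⟶ A :=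
    (NonUnitalAlgHom.snd F A.carrier A.carrier).comp (NonUnitalSubalgebraClass.subtype K)
  have hpq : p ≫ f = q ≫ f := NonUnitalAlgHom.ext fun x => x.2
  have h : p = q := (cancel_mono f).mp hpq
  exact DFunLike.congr_fun (F := K →ₙₐ[F] A.carrier) h ⟨(a, b), hab⟩

theorem CAssoc.mono_of_injective {F : Type u} [Field F] {A B : CAssoc.{u, v} F} (f : A ⟶ B)
    (hf : Function.Injective (CAssoc.toHom f)) : Mono f where
  right_cancellation {Z} _ _ hgh := NonUnitalAlgHom.ext fun x =>
    hf (DFunLike.congr_fun (F := Z.carrier →ₙₐ[F] B.carrier) hgh x)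

/-- A commutative square in `Assoc F` over a span in `CAssoc F` gives one in `CAssoc F` whose legs
have no larger kernels. -/
theorem CAssoc.exists_commSq {F : Type u} [Field F] {I S T : CAssoc.{u, v} F} (s : I ⟶ S)
    (t : I ⟶ T) {P : Assoc.{u, v} F} (ιS : (CAssoc.U F).obj S ⟶ P)
    (ιT : (CAssoc.U F).obj T ⟶ P) (h : (CAssoc.U F).map s ≫ ιS = (CAssoc.U F).map t ≫ ιT) :
    ∃ (Q : CAssoc.{u, v} F) (κS : S ⟶ Q) (κT : T ⟶ Q), s ≫ κS = t ≫ κT ∧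
      (∀ a b, toHom κS a = toHom κS b → Assoc.toHom ιS a = Assoc.toHom ιS b) ∧
      (∀ a b, toHom κT a = toHom κT b → Assoc.toHom ιT a = Assoc.toHom ιT b) := by
  obtain ⟨Q, κS, κT, hc, hS, hT⟩ := CAssoc.exists_commutative_cocone (toHom s) (toHom t)
    (Assoc.toHom ιS) (Assoc.toHom ιT)
    (fun i => DFunLike.congr_fun (F := I.carrier →ₙₐ[F] P.carrier) h i)
  exact ⟨Q, κS, κT, NonUnitalAlgHom.ext hc, hS, hT⟩

theorem mainTheorem2 {F : Type u} [Field F] {I S T : CAssoc.{u, v} F} (s : I ⟶ S) (t : I ⟶ T) :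
    (HasAmalgam (span s t ⋙ CAssoc.U F) → HasAmalgam (span s t)) ∧
    (∀ (P : Assoc.{u, v} F) (ιS : (CAssoc.U F).obj S ⟶ P) (ιT : (CAssoc.U F).obj T ⟶ P)
        (Q : CAssoc.{u, v} F) (κS : S ⟶ Q) (κT : T ⟶ Q),
      IsPushout ((CAssoc.U F).map s) ((CAssoc.U F).map t) ιS ιT →
      IsPushout s t κS κT →
      (Mono ιS → Mono κS) ∧ (Mono ιT → Mono κT)) := by
  constructor
  · rintro ⟨c, hc⟩
    let ιS : (CAssoc.U F).obj S ⟶ c.pt := c.ι.app WalkingSpan.left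
    let ιT : (CAssoc.U F).obj T ⟶ c.pt := c.ι.app WalkingSpan.right
    let ιI : (CAssoc.U F).obj I ⟶ c.pt := c.ι.app WalkingSpan.zero
    have hs : (CAssoc.U F).map s ≫ ιS = ιI := c.w WalkingSpan.Hom.fst
    have ht : (CAssoc.U F).map t ≫ ιT = ιI := c.w WalkingSpan.Hom.snd
    have : Mono ιS := hc WalkingSpan.left
    have : Mono ιT := hc WalkingSpan.right
    have : Mono ιI := hc WalkingSpan.zero
    obtain ⟨Q, κS, κT, hκ, hS, hT⟩ := CAssoc.exists_commSq s t ιS ιT (hs.trans ht.symm)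
    have hκS : Mono κS :=
      CAssoc.mono_of_injective κS fun a b hab => Assoc.injective_of_mono ιS (hS a b hab)
    have hκT : Mono κT :=
      CAssoc.mono_of_injective κT fun a b hab => Assoc.injective_of_mono ιT (hT a b hab)
    -- An amalgam also needs a monic leg from `I`, here `s ≫ κS`; `s` is monic because `ιI` factors
    -- through it.
    have hms : Mono s := CAssoc.mono_of_injective s fun a b hab => by
      refine Assoc.injective_of_mono ιI ?_
      rw [← hs]
      exact congrArg (Assoc.toHom ιS) hab
    refine ⟨PushoutCocone.mk κS κT hκ, ?_⟩
    rintro (_ | _ | _)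
    · exact mono_comp s κS
    · exact hκS
    · exact hκT
  · intro P ιS ιT Q κS κT hP hQ
    obtain ⟨Q', κS', κT', hκ, hS, hT⟩ := CAssoc.exists_commSq s t ιS ιT hP.w
    have hdS : κS ≫ hQ.desc κS' κT' hκ = κS' := hQ.inl_desc κS' κT' hκ
    have hdT : κT ≫ hQ.desc κS' κT' hκ = κT' := hQ.inr_desc κS' κT' hκ
    refine ⟨fun _ => CAssoc.mono_of_injective κS fun a b hab =>
      Assoc.injective_of_mono ιS (hS a b ?_), fun _ => CAssoc.mono_of_injective κT fun a b hab =>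
      Assoc.injective_of_mono ιT (hT a b ?_)⟩
    · rw [← hdS]
      exact congrArg (CAssoc.toHom (hQ.desc κS' κT' hκ)) hab
    · rw [← hdT]
      exact congrArg (CAssoc.toHom (hQ.desc κS' κT' hκ)) hab
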